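/- Let $V$ be a real Banach space, let $B^*$ be the closed unit ball of its dual $V^*$ with the weak$^*$ topology, and let $\Theta(V)$ be the semigroup of all continuous linear operators $T\colon V\to V$ with $\|T\|\le 1$. The opposite semigroup $\Theta(V)^{op}$ acts on $B^*$ by adjoints, $T\cdot\psi=T^*\psi=\psi\circ T$. Let $\mathcal E(V)$ be the enveloping semigroup of the dynamical system $(\Theta(V)^{op},B^*)$, that is, the closure of $\{\,T^*|_{B^*} : T\in\Theta(V)\,\}$ in $(B^*)^{B^*}$ with the product topology, equipped with the subspace topology. Recall that $V$ is Asplund if every separable closed linear subspace of $V$ has a norm-separable dual. Then the following conditions are equivalent: (1) $V$ is separable and Asplund; (2) if $V$ is infinite-dimensional, then $\mathcal E(V)$ is homeomorphic to the Hilbert cube $[-1,1]^{\mathbb N}$; (3) $\mathcal E(V)$ is metrizable. (For finite-dimensional $V$, condition (2) is void and (1) and (3) always hold; for infinite-dimensional $V$, condition (2) says that $\mathcal E(V)$ is homeomorphic to the Hilbert cube.) -/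

import Mathlib

open TopologicalSpace

/-- A (real) Banach space `V` is Asplund if the dual of every separable closed linear subspace of
`V` is separable in the norm topology. -/
def IsAsplund (V : Type*) [NormedAddCommGroup V] [NormedSpace ℝ V] : Prop :=
  ∀ W : Submodule ℝ V, IsClosed (W : Set V) → SeparableSpace W → SeparableSpace (StrongDual ℝ W)

/-- The monoid `Θ(V)` of all continuous linear operators on `V` of norm at most `1`,
under composition. -/
def contractionMonoid (V : Type*) [NormedAddCommGroup V] [NormedSpace ℝ V] :
    Submonoid (V →L[ℝ] V) where
  carrier := {T | ‖T‖ ≤ 1}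
  one_mem' := ContinuousLinearMap.norm_id_le
  mul_mem' := fun {S T} hS hT =>
    (ContinuousLinearMap.opNorm_comp_le S T).trans (mul_le_one₀ hS (norm_nonneg T) hT)

/-- The closed unit ball `B*` of the dual of `V`. Coerced to a type, it carries the
weak-star topology, as a subspace of `WeakDual ℝ V`. -/
def dualBall (V : Type*) [NormedAddCommGroup V] [NormedSpace ℝ V] : Set (WeakDual ℝ V) :=
  WeakDual.toStrongDual ⁻¹' Metric.closedBall (0 : StrongDual ℝ V) 1

/-- The natural left action of the opposite monoid `Θ(V)ᵒᵖ` on `B*` by adjoint operators: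
`T` sends the functional `ψ` to `T* ψ = ψ ∘ T`. -/
noncomputable instance dualBallAction (V : Type*) [NormedAddCommGroup V] [NormedSpace ℝ V] :
    MulAction (contractionMonoid V)ᵐᵒᵖ (dualBall V) where
  smul T ψ :=
    ⟨StrongDual.toWeakDual
        ((WeakDual.toStrongDual (ψ : WeakDual ℝ V)).comp (T.unop : V →L[ℝ] V)), by
      have hψ : ‖WeakDual.toStrongDual (ψ : WeakDual ℝ V)‖ ≤ 1 := mem_closedBall_zero_iff.1 ψ.2
      exact mem_closedBall_zero_iff.2 ((ContinuousLinearMap.opNorm_comp_le _ _).trans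
        (mul_le_one₀ hψ (norm_nonneg _) T.unop.2))⟩
  one_smul _ := rfl
  mul_smul _ _ _ := rfl

/-- The enveloping (Ellis) semigroup of an action of a monoid `S` on a topological space `X`:
the closure, in `X → X` with the product topology (pointwise convergence), of the set of all
translations `x ↦ s • x`, `s ∈ S`. -/
def ellisSemigroup (S X : Type*) [Monoid S] [TopologicalSpace X] [MulAction S X] : Set (X → X) :=
  closure (Set.range fun (s : S) (x : X) => s • x)

/-- The enveloping semigroup `𝓔(V)` of a Banach space `V`: the enveloping semigroup of the
dynamical system `(Θ(V)ᵒᵖ, B*)`. It carries the topology of pointwise convergence. -/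
def envelopingSemigroup (V : Type*) [NormedAddCommGroup V] [NormedSpace ℝ V] :
    Set (dualBall V → dualBall V) :=
  ellisSemigroup (contractionMonoid V)ᵐᵒᵖ (dualBall V)

/-!
The matrix coefficients `p ↦ ⟨v, p ψ⟩`, for `ψ ∈ B*` and `v ∈ V`, are continuous functions on the
compact space `𝓔(V)`, and they carry both directions of the equivalence.

If `𝓔(V)` is metrizable, then `C(𝓔(V))` is separable. Fix a unit vector `w`. Since rank-one
contractions move `w` to any point of the unit ball of `V`, the map `ψ ↦ (p ↦ ⟨w, p ψ⟩)` is an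
isometric embedding of `B*` with its norm metric into `C(𝓔(V))`
(`dist_matrixCoeffMap_left`); likewise `V` embeds isometrically
(`dist_matrixCoeffMap_right`). So `V` and `V*` are norm separable, and then so is the dual of every
subspace, by Hahn–Banach.

If `V` and `V*` are separable, then countably many matrix coefficients separate the points of
`𝓔(V)`, because elements of `𝓔(V)` are `1`-Lipschitz for the norm (`eq_of_matrixCoeff_eq`). If `V`
is infinite-dimensional, these can be thinned out to a sequence that is linearly independent on the
space of operators. It maps `𝓔(V)` homeomorphically onto a compact set `K` of real sequences, namely
the closure of a linear image of the unit ball of operators. Hence `K` is convex, and by the open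
mapping theorem each projection of `K` to `ℝⁿ` is a neighbourhood of `0`.

That such a `K` is a Hilbert cube is Keller's theorem (`nonempty_homeomorph_hilbertCube`). The
projection `Bₙ` of `K` to `ℝⁿ` is a convex body, hence a cube; the point is to choose homeomorphisms
`hₙ` of `Bₙ` with the `n`-cube that are almost compatible with the projections. This is possible by
`exists_straighten_convexBody`: a convex body `D ⊆ E × ℝ` with projection `C` is homeomorphic to
`C × [-1, 1]` by a map moving the `E`-coordinate arbitrarily little. Indeed, `D` is close to
`D' = (1 + δ) D ∩ (C × ℝ)`, so that the radial homeomorphism from `D` to `D'` moves points little,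
and the fibres of `D'` over `C` are nondegenerate intervals whose end points are restrictions to `C`
of convex and concave functions defined on a neighbourhood of `C`, hence continuous. If the errors
decrease fast enough compared with the injectivity of the `hₙ`, then the `hₙ` converge to a
homeomorphism of `K` with the Hilbert cube.
-/

/-! ### Straightening a convex body over its projection -/

section Straightening

open scoped Pointwise

/-- If `s ⊆ t ⊆ (1 + ε) s`, then rescaling the gauge of `s` to that of `t` moves points by a
relative amount at most `ε`. -/
theorem dist_gaugeRescale_le {E : Type*} [NormedAddCommGroup E] [NormedSpace ℝ E] {s t : Set E}
    {ε : ℝ} (hε : 0 < ε) (hs₀ : s ∈ nhds 0) (ht₀ : t ∈ nhds 0)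
    (htb : Bornology.IsVonNBounded ℝ t) (hst : s ⊆ t) (hts : t ⊆ (1 + ε) • s) (x : E) :
    dist (gaugeRescale s t x) x ≤ ε * ‖x‖ := by
  rcases eq_or_ne x 0 with rfl | hx
  · simp
  have hpos : 0 < gauge t x := (gauge_pos (absorbent_nhds_zero ht₀) htb).2 hx
  have h1 : gauge t x ≤ gauge s x := gauge_mono (absorbent_nhds_zero hs₀) hst x
  have h2 : gauge s x ≤ (1 + ε) * gauge t x := by
    have h := gauge_mono (absorbent_nhds_zero ht₀) hts x
    rw [gauge_smul_left_of_nonneg (by positivity : (0 : ℝ) ≤ 1 + ε)] at h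
    simp only [Pi.smul_apply, smul_eq_mul] at h
    rwa [inv_mul_le_iff₀ (by positivity)] at h
  have h3 : gaugeRescale s t x - x = (gauge s x / gauge t x - 1) • x := by
    rw [gaugeRescale_def, sub_smul, one_smul]
  rw [dist_eq_norm, h3, norm_smul]
  gcongr
  rw [Real.norm_eq_abs, abs_le]
  constructor
  · have : 1 ≤ gauge s x / gauge t x := (one_le_div hpos).2 h1
    linarith
  · have : gauge s x / gauge t x ≤ 1 + ε := (div_le_iff₀ hpos).2 h2
    linarith

/-- A region between two continuous graphs is straightened fibrewise to a product. -/
theorem exists_straighten_between_graphs {E : Type*} [TopologicalSpace E] {C : Set E} {a b : E → ℝ}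
    (ha : ContinuousOn a C) (hb : ContinuousOn b C) (hab : ∀ y ∈ C, a y < b y) :
    ∃ φ : E × ℝ → E × ℝ, ContinuousOn φ {p | p.1 ∈ C ∧ p.2 ∈ Set.Icc (a p.1) (b p.1)} ∧
      Set.BijOn φ {p | p.1 ∈ C ∧ p.2 ∈ Set.Icc (a p.1) (b p.1)} (C ×ˢ Set.Icc (-1) 1) ∧
      ∀ p, (φ p).1 = p.1 := by
  refine ⟨fun p => (p.1, (2 * p.2 - a p.1 - b p.1) / (b p.1 - a p.1)), ?_, ⟨?_, ?_, ?_⟩,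
    fun _ => rfl⟩
  · have hm : Set.MapsTo Prod.fst {p : E × ℝ | p.1 ∈ C ∧ p.2 ∈ Set.Icc (a p.1) (b p.1)} C :=
      fun p hp => hp.1
    have ha' := ha.comp continuous_fst.continuousOn hm
    have hb' := hb.comp continuous_fst.continuousOn hm
    refine continuous_fst.continuousOn.prodMk (ContinuousOn.div ?_ (hb'.sub ha') ?_)
    · exact ((continuous_const.mul continuous_snd).continuousOn.sub ha').sub hb'
    · intro p hp
      exact (sub_pos.2 (hab _ hp.1)).ne'
  · rintro ⟨y, t⟩ ⟨hy, h1, h2⟩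
    have h := sub_pos.2 (hab y hy)
    simp only at h1 h2 hy
    refine ⟨hy, ?_, ?_⟩
    · simp only
      rw [le_div_iff₀ h]; linarith
    · simp only
      rw [div_le_iff₀ h]; linarith
  · rintro ⟨y, t⟩ ⟨hy, -⟩ ⟨y', t'⟩ - heq
    simp only [Prod.mk.injEq] at heq hy
    obtain ⟨rfl, h⟩ := heq
    have hne := (sub_pos.2 (hab y hy)).ne'
    rw [div_left_inj' hne] at h
    simp only [Prod.mk.injEq, true_and]
    linarith
  · rintro ⟨y, u⟩ ⟨hy, h1, h2⟩
    simp only at hy h1 h2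
    have h := sub_pos.2 (hab y hy)
    refine ⟨(y, (u * (b y - a y) + a y + b y) / 2), ⟨hy, ?_, ?_⟩, ?_⟩
    · simp only
      nlinarith
    · simp only
      nlinarith
    · simp only [Prod.mk.injEq, true_and]
      field_simp
      ring

/-- The fibres of a compact convex set in `E × ℝ` are compact intervals. -/
theorem fibre_eq_Icc {E : Type*} [TopologicalSpace E] [T2Space E] [AddCommGroup E] [Module ℝ E]
    {A : Set (E × ℝ)}
    (hA : Convex ℝ A) (hAc : IsCompact A) {y : E} (hy : y ∈ Prod.fst '' A) :
    {t | (y, t) ∈ A} = Set.Icc (sInf {t | (y, t) ∈ A}) (sSup {t | (y, t) ∈ A}) := by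
  have hc : IsCompact {t | (y, t) ∈ A} := by
    have : {t : ℝ | (y, t) ∈ A} = Prod.snd '' (A ∩ Prod.fst ⁻¹' {y}) := by
      ext t; simp
    rw [this]
    exact (hAc.inter_right (isClosed_singleton.preimage continuous_fst)).image continuous_snd
  have hne : {t | (y, t) ∈ A}.Nonempty := by
    obtain ⟨⟨_, t⟩, h, rfl⟩ := hy
    exact ⟨t, h⟩
  have hconv : Convex ℝ {t | (y, t) ∈ A} := by
    intro t ht u hu p q hp hq hpq
    have := hA ht hu hp hq hpq
    simpa [← add_smul, hpq] using this
  exact eq_Icc_of_connected_compact ⟨hne, hconv.isPreconnected⟩ hc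

theorem concaveOn_sSup_fibre {E : Type*} [TopologicalSpace E] [T2Space E] [AddCommGroup E]
    [Module ℝ E] {A : Set (E × ℝ)} (hA : Convex ℝ A) (hAc : IsCompact A) :
    ConcaveOn ℝ (Prod.fst '' A) fun y => sSup {t | (y, t) ∈ A} := by
  have hP : Convex ℝ (Prod.fst '' A) := hA.linear_image (LinearMap.fst ℝ E ℝ)
  have key : ∀ y ∈ Prod.fst '' A, (y, sSup {t | (y, t) ∈ A}) ∈ A := by
    intro y hy
    have h := fibre_eq_Icc hA hAc hy
    have hne : {t | (y, t) ∈ A}.Nonempty := by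
      obtain ⟨⟨_, t⟩, ht, rfl⟩ := hy
      exact ⟨t, ht⟩
    obtain ⟨t, ht⟩ := hne
    rw [h] at ht
    exact h.symm.subset (Set.right_mem_Icc.2 (ht.1.trans ht.2))
  refine ⟨hP, fun y hy z hz p q hp hq hpq => ?_⟩
  have h := (fibre_eq_Icc hA hAc (hP hy hz hp hq hpq)).subset
    (show _ ∈ A from hA (key y hy) (key z hz) hp hq hpq)
  exact h.2

theorem convexOn_sInf_fibre {E : Type*} [TopologicalSpace E] [T2Space E] [AddCommGroup E]
    [Module ℝ E] {A : Set (E × ℝ)} (hA : Convex ℝ A) (hAc : IsCompact A) :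
    ConvexOn ℝ (Prod.fst '' A) fun y => sInf {t | (y, t) ∈ A} := by
  have hP : Convex ℝ (Prod.fst '' A) := hA.linear_image (LinearMap.fst ℝ E ℝ)
  have key : ∀ y ∈ Prod.fst '' A, (y, sInf {t | (y, t) ∈ A}) ∈ A := by
    intro y hy
    have h := fibre_eq_Icc hA hAc hy
    have hne : {t | (y, t) ∈ A}.Nonempty := by
      obtain ⟨⟨_, t⟩, ht, rfl⟩ := hy
      exact ⟨t, ht⟩
    obtain ⟨t, ht⟩ := hne
    rw [h] at ht
    exact h.symm.subset (Set.left_mem_Icc.2 (ht.1.trans ht.2))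
  refine ⟨hP, fun y hy z hz p q hp hq hpq => ?_⟩
  have h := (fibre_eq_Icc hA hAc (hP hy hz hp hq hpq)).subset
    (show _ ∈ A from hA (key y hy) (key z hz) hp hq hpq)
  exact h.1

/-- The dilation `(1 + ε) D` of a convex set contains the Minkowski sum `D + ε D`. -/
theorem add_smul_mem_dilation {E : Type*} [AddCommGroup E] [Module ℝ E] {D : Set E}
    (hD : Convex ℝ D) {ε : ℝ} (hε : 0 ≤ ε) {x y : E} (hx : x ∈ D) (hy : y ∈ D) :
    x + ε • y ∈ (1 + ε) • D := by
  rw [hD.add_smul zero_le_one hε, one_smul]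
  exact Set.add_mem_add hx (Set.smul_mem_smul_set hy)

/-- A convex body `D` in `E × ℝ` is homeomorphic to the product of its projection to `E` with an
interval, by a homeomorphism that moves the `E`-coordinate as little as desired. The body `D` is
first enlarged to the part of `(1 + δ) D` lying over the projection of `D`: the fibres of the
enlarged body do not degenerate at the boundary and their end points vary continuously. -/
theorem exists_straighten_convexBody {E : Type*} [NormedAddCommGroup E] [NormedSpace ℝ E]
    [FiniteDimensional ℝ E] {D : Set (E × ℝ)} (hD : Convex ℝ D) (hDc : IsCompact D)
    (hD₀ : D ∈ nhds 0) {ε : ℝ} (hε : 0 < ε) :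
    ∃ g : E × ℝ → E × ℝ, ContinuousOn g D ∧ Set.BijOn g D ((Prod.fst '' D) ×ˢ Set.Icc (-1) 1) ∧
      ∀ x ∈ D, dist (g x).1 x.1 < ε := by
  obtain ⟨R, hR, hDR⟩ : ∃ R > 0, ∀ x ∈ D, ‖x‖ ≤ R := hDc.isBounded.exists_pos_norm_le
  obtain ⟨δ, hδ, hδR⟩ : ∃ δ > 0, δ * R < ε := ⟨ε / (2 * R), by positivity, by
    field_simp; linarith⟩
  obtain ⟨r, hr, hrD⟩ := Metric.mem_nhds_iff.1 hD₀
  set C : Set E := Prod.fst '' D with hC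
  set A : Set (E × ℝ) := (1 + δ) • D with hAdef
  have hA : Convex ℝ A := hD.smul _
  have hAc : IsCompact A := hDc.smul _
  have hDA : D ⊆ A := by
    intro x hx
    simpa using add_smul_mem_dilation hD hδ.le hx (mem_of_mem_nhds hD₀)
  set T : Set (E × ℝ) := A ∩ Prod.fst ⁻¹' C with hT
  have hCc : IsCompact C := hDc.image continuous_fst
  have hCconv : Convex ℝ C := hD.linear_image (LinearMap.fst ℝ E ℝ)
  have hTconv : Convex ℝ T := hA.inter (hCconv.linear_preimage (LinearMap.fst ℝ E ℝ))
  have hTc : IsCompact T := hAc.inter_right (hCc.isClosed.preimage continuous_fst)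
  have hDT : D ⊆ T := fun x hx => ⟨hDA hx, Set.mem_image_of_mem _ hx⟩
  have hT₀ : T ∈ nhds 0 := Filter.mem_of_superset hD₀ hDT
  have hDb : Bornology.IsVonNBounded ℝ D := NormedSpace.isVonNBounded_of_isBounded _ hDc.isBounded
  have hTb : Bornology.IsVonNBounded ℝ T := NormedSpace.isVonNBounded_of_isBounded _ hTc.isBounded
  set ρ := gaugeRescaleHomeomorph D T hD hD₀ hDb hTconv hT₀ hTb with hρ
  have hρim : ρ '' D = T := by
    have h := image_gaugeRescaleHomeomorph_closure hD hD₀ hDb hTconv hT₀ hTb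
    rwa [hDc.isClosed.closure_eq, hTc.isClosed.closure_eq] at h
  have hρd : ∀ x ∈ D, dist (ρ x) x < ε := fun x hx =>
    ((dist_gaugeRescale_le hδ hD₀ hT₀ hTb hDT Set.inter_subset_left x).trans
      (mul_le_mul_of_nonneg_left (hDR x hx) hδ.le)).trans_lt hδR
  -- the projection of `(1 + δ) D` is a neighbourhood of `C`
  have hCA : C ⊆ interior (Prod.fst '' A) := by
    rintro _ ⟨x, hx, rfl⟩
    rw [mem_interior_iff_mem_nhds, Metric.mem_nhds_iff]
    refine ⟨δ * r, by positivity, fun y hy => ?_⟩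
    have hz : ((δ⁻¹ • (y - x.1), 0) : E × ℝ) ∈ D := by
      apply hrD
      rw [mem_ball_zero_iff, Prod.norm_mk, norm_zero, max_eq_left (norm_nonneg _), norm_smul,
        Real.norm_eq_abs, abs_of_pos (inv_pos.2 hδ), inv_mul_lt_iff₀ hδ]
      rwa [mem_ball_iff_norm] at hy
    refine ⟨_, add_smul_mem_dilation hD hδ.le hx hz, ?_⟩
    simp [smul_smul, hδ.ne']
  have hCA' : C ⊆ Prod.fst '' A := hCA.trans interior_subset
  obtain ⟨φ, hφc, hφb, hφ1⟩ := exists_straighten_between_graphs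
    ((convexOn_sInf_fibre hA hAc).continuousOn_interior.mono hCA)
    ((concaveOn_sSup_fibre hA hAc).continuousOn_interior.mono hCA) (by
      rintro _ ⟨x, hx, rfl⟩
      -- the fibre of `(1 + δ) D` over a point of `C` contains two points
      have hv : ((0, r / 2) : E × ℝ) ∈ D := hrD (by
        rw [mem_ball_zero_iff, Prod.norm_mk, norm_zero, max_eq_right (norm_nonneg _),
          Real.norm_eq_abs, abs_of_pos (by positivity)]
        linarith)
      have h1 : x.2 ∈ {t | (x.1, t) ∈ A} := hDA hx
      have h2 : x.2 + δ * (r / 2) ∈ {t | (x.1, t) ∈ A} := by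
        have := add_smul_mem_dilation hD hδ.le hx hv
        simpa [Prod.ext_iff, Prod.add_def] using this
      rw [fibre_eq_Icc hA hAc (hCA' ⟨x, hx, rfl⟩)] at h1 h2
      have : 0 < δ * (r / 2) := by positivity
      linarith [h1.1, h2.2])
  have hTeq : {p : E × ℝ | p.1 ∈ C ∧
      p.2 ∈ Set.Icc (sInf {t | (p.1, t) ∈ A}) (sSup {t | (p.1, t) ∈ A})} = T := by
    ext ⟨y, t⟩
    simp only [Set.mem_ofPred_eq, hT, Set.mem_inter_iff, Set.mem_preimage]
    constructor
    · rintro ⟨hy, h⟩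
      rw [← fibre_eq_Icc hA hAc (hCA' hy)] at h
      exact ⟨h, hy⟩
    · rintro ⟨h, hy⟩
      exact ⟨hy, (fibre_eq_Icc hA hAc (hCA' hy)).subset h⟩
  rw [hTeq] at hφc hφb
  have hρmaps : Set.BijOn ρ D T := ⟨fun x hx => hρim ▸ Set.mem_image_of_mem ρ hx,
    ρ.injective.injOn, hρim.superset⟩
  refine ⟨φ ∘ ρ, hφc.comp ρ.continuous.continuousOn hρmaps.mapsTo, hφb.comp hρmaps, fun x hx => ?_⟩
  rw [Function.comp_apply, hφ1]
  exact (le_max_left _ _).trans_lt (hρd x hx)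

end Straightening

/-! ### Keller's theorem -/

/-- Restriction of a real sequence to its first `n` terms. -/
def firstTerms (n : ℕ) : (ℕ → ℝ) →L[ℝ] (Fin n → ℝ) :=
  ContinuousLinearMap.pi fun i => ContinuousLinearMap.proj (i : ℕ)

theorem init_firstTerms (n : ℕ) (x : ℕ → ℝ) : Fin.init (firstTerms (n + 1) x) = firstTerms n x :=
  rfl

theorem snoc_firstTerms (n : ℕ) (x : ℕ → ℝ) :
    (Fin.snoc (firstTerms n x) (x n) : Fin (n + 1) → ℝ) = firstTerms (n + 1) x := by
  rw [← init_firstTerms, show x n = firstTerms (n + 1) x (Fin.last n) from rfl, Fin.snoc_init_self]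

/-- The inverse of a continuous injection of a compact set is uniformly continuous. -/
theorem exists_dist_image_separation {E F : Type*} [MetricSpace E] [MetricSpace F] {B : Set E}
    (hB : IsCompact B) {h : E → F} (hc : ContinuousOn h B) (hi : Set.InjOn h B) {η : ℝ}
    (hη : 0 < η) :
    ∃ δ > 0, ∀ x ∈ B, ∀ y ∈ B, dist (h x) (h y) ≤ δ → dist x y < η := by
  have hS : IsCompact ((B ×ˢ B) ∩ {p : E × E | η ≤ dist p.1 p.2}) :=
    (hB.prod hB).inter_right (isClosed_le continuous_const continuous_dist)
  have hf : ContinuousOn (fun p : E × E => dist (h p.1) (h p.2))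
      ((B ×ˢ B) ∩ {p : E × E | η ≤ dist p.1 p.2}) :=
    continuous_dist.comp_continuousOn
      ((ContinuousOn.comp (t := B) hc continuous_fst.continuousOn fun _ hp => hp.1.1).prodMk
        (ContinuousOn.comp (t := B) hc continuous_snd.continuousOn fun _ hp => hp.1.2))
  obtain ⟨a, ha, hmin⟩ := hS.exists_forall_le' hf (a := 0) (by
    rintro ⟨x, y⟩ ⟨⟨hx, hy⟩, hxy⟩
    refine dist_pos.2 fun heq => ?_
    have h1 : x = y := hi hx hy heq
    have h2 : η ≤ dist x y := hxy
    rw [h1, dist_self] at h2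
    exact h2.not_gt hη)
  refine ⟨a / 2, half_pos ha, fun x hx y hy hle => ?_⟩
  by_contra! hcon
  have := hmin (x, y) ⟨⟨hx, hy⟩, hcon⟩
  simp only at this
  linarith

/-- A homeomorphism between the projection of `K` to `ℝⁿ` and the `n`-dimensional cube, encoded as
a continuous bijection since the projection is compact in the application. The number
`tol` quantifies the injectivity: points that are still `4 * tol`-close in the cube
are `1 / (n + 1)`-close in the projection of `K`. -/
structure CubeChart (K : Set (ℕ → ℝ)) (n : ℕ) where
  toFun : (Fin n → ℝ) → (Fin n → ℝ)
  continuousOn : ContinuousOn toFun (firstTerms n '' K)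
  bijOn : Set.BijOn toFun (firstTerms n '' K) (Set.Icc (-1) 1)
  tol : ℝ
  tol_pos : 0 < tol
  dist_lt : ∀ x ∈ firstTerms n '' K, ∀ y ∈ firstTerms n '' K,
    dist (toFun x) (toFun y) ≤ 4 * tol → dist x y < 1 / ((n : ℝ) + 1)

theorem CubeChart.nonempty_zero {K : Set (ℕ → ℝ)} (hK : K.Nonempty) :
    Nonempty (CubeChart K 0) := by
  refine ⟨⟨id, continuousOn_id, ⟨fun x _ => ⟨fun i => i.elim0, fun i => i.elim0⟩,
    Set.injOn_id _, fun x _ => ?_⟩, 1, one_pos, fun x _ y _ _ => ?_⟩⟩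
  · obtain ⟨y, hy⟩ := hK
    exact ⟨firstTerms 0 y, Set.mem_image_of_mem _ hy, Subsingleton.elim _ _⟩
  · rw [Subsingleton.elim x y, dist_self]
    positivity

/-- A chart of the `n`-dimensional projection of a convex set extends, up to an arbitrarily small
error, to a chart of the `(n + 1)`-dimensional projection. -/
theorem CubeChart.exists_succ {K : Set (ℕ → ℝ)} (hK : IsCompact K) (hconv : Convex ℝ K) {n : ℕ}
    (h₀ : firstTerms (n + 1) '' K ∈ nhds 0) (s : CubeChart K n) :
    ∃ s' : CubeChart K (n + 1), s'.tol ≤ s.tol / 2 ∧ ∀ x ∈ K,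
      dist (Fin.init (s'.toFun (firstTerms (n + 1) x)) : Fin n → ℝ)
        (s.toFun (firstTerms n x)) ≤ s.tol := by
  set D : Set ((Fin n → ℝ) × ℝ) :=
    ((firstTerms n).prod (ContinuousLinearMap.proj n : (ℕ → ℝ) →L[ℝ] ℝ)) '' K with hDdef
  have hDc : IsCompact D := hK.image (ContinuousLinearMap.continuous _)
  have hD : Convex ℝ D := hconv.linear_image
    ((firstTerms n).prod (ContinuousLinearMap.proj n : (ℕ → ℝ) →L[ℝ] ℝ)).toLinearMap
  have hBc : IsCompact (firstTerms n '' K) := hK.image (firstTerms n).continuous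
  have hBc' : IsCompact (firstTerms (n + 1) '' K) := hK.image (firstTerms (n + 1)).continuous
  have hsnoc : Continuous fun p : (Fin n → ℝ) × ℝ => (Fin.snoc p.1 p.2 : Fin (n + 1) → ℝ) :=
    Continuous.finSnoc (A := fun _ => ℝ) continuous_fst continuous_snd
  have hfst : Prod.fst '' D = firstTerms n '' K := by
    rw [hDdef, Set.image_image]; rfl
  have hsplit : Set.BijOn (fun x : Fin (n + 1) → ℝ => (Fin.init x, x (Fin.last n)))
      (firstTerms (n + 1) '' K) D := by
    refine ⟨?_, ?_, ?_⟩
    · rintro _ ⟨x, hx, rfl⟩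
      exact ⟨x, hx, rfl⟩
    · intro x _ y _ hxy
      simp only [Prod.mk.injEq] at hxy
      rw [← Fin.snoc_init_self x, ← Fin.snoc_init_self y, hxy.1, hxy.2]
    · rintro _ ⟨x, hx, rfl⟩
      exact ⟨firstTerms (n + 1) x, Set.mem_image_of_mem _ hx, rfl⟩
  have hD₀ : D ∈ nhds 0 := by
    have h1 : (fun p : (Fin n → ℝ) × ℝ => (Fin.snoc p.1 p.2 : Fin (n + 1) → ℝ)) ⁻¹'
        (firstTerms (n + 1) '' K) ∈ nhds 0 := by
      apply hsnoc.continuousAt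
      convert h₀
      ext i
      refine Fin.lastCases ?_ (fun j => ?_) i <;> simp
    refine Filter.mem_of_superset h1 ?_
    rintro ⟨y, t⟩ ⟨x, hx, hxy⟩
    refine ⟨x, hx, ?_⟩
    simp only at hxy
    rw [← snoc_firstTerms] at hxy
    have := Fin.snoc_injective2 hxy
    exact Prod.ext this.1 this.2
  -- straighten within the modulus of continuity of `s` for the error `s.tol`
  obtain ⟨δ, hδ, hδs⟩ := Metric.uniformContinuousOn_iff.1
    (hBc.uniformContinuousOn_of_continuous s.continuousOn) s.tol s.tol_pos
  obtain ⟨g, hgc, hgb, hgd⟩ := exists_straighten_convexBody hD hDc hD₀ hδ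
  rw [hfst] at hgb
  set h' : (Fin (n + 1) → ℝ) → (Fin (n + 1) → ℝ) := fun x =>
    Fin.snoc (s.toFun (g (Fin.init x, x (Fin.last n))).1) (g (Fin.init x, x (Fin.last n))).2
    with hh'
  have hgs := hgb.comp hsplit
  have hc' : ContinuousOn h' (firstTerms (n + 1) '' K) := by
    have h1 : ContinuousOn (fun x : Fin (n + 1) → ℝ => g (Fin.init x, x (Fin.last n)))
        (firstTerms (n + 1) '' K) :=
      hgc.comp (Continuous.continuousOn (by unfold Fin.init; fun_prop)) hsplit.mapsTo
    have h2 : ContinuousOn (fun x : Fin (n + 1) → ℝ =>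
        s.toFun (g (Fin.init x, x (Fin.last n))).1) (firstTerms (n + 1) '' K) :=
      s.continuousOn.comp h1.fst fun x hx => (hgs.mapsTo hx).1
    exact hsnoc.comp_continuousOn (h2.prodMk h1.snd)
  have hb' : Set.BijOn h' (firstTerms (n + 1) '' K) (Set.Icc (-1) 1) := by
    have h1 : Set.BijOn (fun p : (Fin n → ℝ) × ℝ => (Fin.snoc (s.toFun p.1) p.2 : Fin (n + 1) → ℝ))
        ((firstTerms n '' K) ×ˢ Set.Icc (-1) 1) (Set.Icc (-1) 1) := by
      refine ⟨?_, ?_, ?_⟩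
      · rintro ⟨y, t⟩ ⟨hy, ht⟩
        have h := s.bijOn.mapsTo hy
        constructor <;> intro i <;> refine Fin.lastCases ?_ (fun j => ?_) i
        · simpa using ht.1
        · simpa using h.1 j
        · simpa using ht.2
        · simpa using h.2 j
      · rintro ⟨y, t⟩ ⟨hy, ht⟩ ⟨y', t'⟩ ⟨hy', ht'⟩ heq
        have := Fin.snoc_injective2 heq
        exact Prod.ext (s.bijOn.injOn hy hy' this.1) this.2
      · intro u hu
        obtain ⟨y, hy, hyu⟩ := s.bijOn.surjOn
          (show (Fin.init u : Fin n → ℝ) ∈ Set.Icc (-1) 1 from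
            ⟨fun j => hu.1 j.castSucc, fun j => hu.2 j.castSucc⟩)
        refine ⟨(y, u (Fin.last n)), ⟨hy, hu.1 _, hu.2 _⟩, ?_⟩
        simp only [hyu, Fin.snoc_init_self]
    exact h1.comp hgs
  obtain ⟨ε, hε, hsep⟩ := exists_dist_image_separation hBc' hc' hb'.injOn
    (show (0 : ℝ) < 1 / (((n + 1 : ℕ) : ℝ) + 1) by positivity)
  refine ⟨⟨h', hc', hb', min (ε / 4) (s.tol / 2), lt_min (by positivity) (half_pos s.tol_pos),
    fun x hx y hy hxy => hsep x hx y hy (hxy.trans ?_)⟩, min_le_right _ _, fun x hx => ?_⟩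
  · have := min_le_left (ε / 4) (s.tol / 2)
    linarith
  · simp only [hh', Fin.init_snoc]
    have hxD : (Fin.init (firstTerms (n + 1) x), firstTerms (n + 1) x (Fin.last n)) ∈ D :=
      hsplit.mapsTo (Set.mem_image_of_mem _ hx)
    exact (hδs _ (hgb.mapsTo hxD).1 _ (Set.mem_image_of_mem _ hx) (hgd _ hxD)).le

/-- **Keller's theorem**: a compact convex set of real sequences all of whose finite-dimensional
projections are neighbourhoods of the origin is homeomorphic to the Hilbert cube. The homeomorphism
is the limit of charts of the finite-dimensional projections, each approximately extending the
previous one. -/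
theorem nonempty_homeomorph_hilbertCube {K : Set (ℕ → ℝ)} (hK : IsCompact K) (hconv : Convex ℝ K)
    (h₀ : ∀ n, firstTerms n '' K ∈ nhds 0) :
    Nonempty (K ≃ₜ (ℕ → Set.Icc (-1 : ℝ) 1)) := by
  have hne : K.Nonempty := (Set.image_nonempty.1 ⟨0, mem_of_mem_nhds (h₀ 0)⟩)
  obtain ⟨s0⟩ := CubeChart.nonempty_zero hne
  choose next hnext1 hnext2 using fun (n : ℕ) (s : CubeChart K n) =>
    s.exists_succ hK hconv (h₀ (n + 1))
  let s : ∀ n, CubeChart K n := fun n => Nat.rec s0 next n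
  have htol : ∀ n, (s (n + 1)).tol ≤ (s n).tol / 2 := fun n => hnext1 n (s n)
  have hstep : ∀ n, ∀ x ∈ K, dist (Fin.init ((s (n + 1)).toFun (firstTerms (n + 1) x)))
      ((s n).toFun (firstTerms n x)) ≤ (s n).tol := fun n => hnext2 n (s n)
  clear_value s
  have hgeo : ∀ n j, (s (n + j)).tol ≤ (s n).tol / 2 ^ j := by
    intro n j
    induction j with
    | zero => simp
    | succ j ih =>
      have := htol (n + j)
      rw [← add_assoc, pow_succ, ← div_div]
      linarith
  have htend : Filter.Tendsto (fun n => 2 * (s n).tol) Filter.atTop (nhds 0) := by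
    have h1 : Filter.Tendsto (fun n : ℕ => 2 * ((s 0).tol * (1 / 2) ^ n)) Filter.atTop (nhds 0) := by
      simpa using ((tendsto_pow_atTop_nhds_zero_of_lt_one (r := (1 / 2 : ℝ)) (by norm_num)
        (by norm_num)).const_mul (s 0).tol).const_mul 2
    refine squeeze_zero (fun n => mul_nonneg two_pos.le (s n).tol_pos.le) (fun n => ?_) h1
    have := hgeo 0 n
    rw [zero_add] at this
    rw [one_div, inv_pow, ← div_eq_mul_inv]
    linarith
  -- the `k`-th coordinate of the chart number `n`, for `k < n`
  let u : K → ℕ → ℕ → ℝ := fun x k n =>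
    if hk : k < n then (s n).toFun (firstTerms n x) ⟨k, hk⟩ else 0
  have hu : ∀ x k n (hk : k < n), u x k n = (s n).toFun (firstTerms n x) ⟨k, hk⟩ :=
    fun x k n hk => dif_pos hk
  have hustep : ∀ x k n, k < n → dist (u x k n) (u x k (n + 1)) ≤ (s n).tol := by
    intro x k n hk
    rw [hu x k n hk, hu x k (n + 1) (hk.trans n.lt_succ_self), dist_comm]
    exact (dist_le_pi_dist (Fin.init ((s (n + 1)).toFun (firstTerms (n + 1) x)))
      ((s n).toFun (firstTerms n x)) ⟨k, hk⟩).trans (hstep n x x.2)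
  have hugeo : ∀ x k n, k < n → ∀ j, dist (u x k (n + j)) (u x k (n + (j + 1))) ≤
      2 * (s n).tol / 2 / 2 ^ j := by
    intro x k n hk j
    rw [mul_div_cancel_left₀ _ two_ne_zero]
    exact (hustep x k (n + j) (by omega)).trans (hgeo n j)
  have hlim : ∀ x k, ∃ l, Filter.Tendsto (u x k) Filter.atTop (nhds l) := by
    intro x k
    obtain ⟨l, hl⟩ := cauchySeq_tendsto_of_complete
      (cauchySeq_of_le_geometric_two (hugeo x k (k + 1) k.lt_succ_self))
    refine ⟨l, (Filter.tendsto_add_atTop_iff_nat (k + 1)).1 ?_⟩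
    simpa only [add_comm] using hl
  choose L hL using hlim
  have hdist : ∀ x k n, k < n → dist (u x k n) (L x k) ≤ 2 * (s n).tol := by
    intro x k n hk
    refine dist_le_of_le_geometric_two_of_tendsto₀ (hugeo x k n hk) ?_
    simpa only [add_comm] using (Filter.tendsto_add_atTop_iff_nat n).2 (hL x k)
  have hmem : ∀ x k n, k < n → u x k n ∈ Set.Icc (-1 : ℝ) 1 := by
    intro x k n hk
    rw [hu x k n hk]
    have := (s n).bijOn.mapsTo (Set.mem_image_of_mem _ x.2)
    exact ⟨this.1 _, this.2 _⟩
  have hLmem : ∀ x k, L x k ∈ Set.Icc (-1 : ℝ) 1 := fun x k =>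
    isClosed_Icc.mem_of_tendsto (hL x k)
      ((Filter.eventually_gt_atTop k).mono fun n hn => hmem x k n hn)
  have hucont : ∀ k n, k < n → Continuous fun x => u x k n := by
    intro k n hk
    simp only [hu _ k n hk]
    have h1 : Continuous fun x : K => (s n).toFun (firstTerms n x) :=
      (s n).continuousOn.comp_continuous
        ((firstTerms n).continuous.comp continuous_subtype_val)
        fun x => Set.mem_image_of_mem _ x.2
    exact (continuous_apply _).comp h1
  have hLcont : ∀ k, Continuous fun x => L x k := by
    intro k
    have hunif : TendstoUniformly (fun n x => u x k n) (fun x => L x k) Filter.atTop := by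
      rw [Metric.tendstoUniformly_iff]
      intro ε hε
      filter_upwards [htend.eventually (gt_mem_nhds hε), Filter.eventually_gt_atTop k]
        with n hn hk x
      rw [dist_comm]
      exact (hdist x k n hk).trans_lt hn
    exact hunif.continuous ((Filter.eventually_gt_atTop k).mono fun n hn => hucont k n hn).frequently
  let H : K → (ℕ → Set.Icc (-1 : ℝ) 1) := fun x k => ⟨L x k, hLmem x k⟩
  have hHcont : Continuous H := continuous_pi fun k => (hLcont k).subtype_mk _
  have hinj : Function.Injective H := by
    intro x y hxy
    have hLxy : ∀ k, L x k = L y k := fun k => congrArg Subtype.val (congrFun hxy k)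
    have hclose : ∀ n, dist (firstTerms n x) (firstTerms n y) < 1 / ((n : ℝ) + 1) := by
      intro n
      refine (s n).dist_lt _ (Set.mem_image_of_mem _ x.2) _ (Set.mem_image_of_mem _ y.2) ?_
      refine (dist_pi_le_iff (by linarith [(s n).tol_pos])).2 fun i => ?_
      have h1 := hdist x i n i.2
      have h2 := hdist y i n i.2
      rw [hu _ _ _ i.2] at h1 h2
      rw [← hLxy] at h2
      linarith [dist_triangle_right ((s n).toFun (firstTerms n x) i)
        ((s n).toFun (firstTerms n y) i) (L x i)]
    ext k
    refine eq_of_dist_eq_zero (le_antisymm ?_ dist_nonneg)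
    refine ge_of_tendsto tendsto_one_div_add_atTop_nhds_zero_nat
      ((Filter.eventually_gt_atTop k).mono fun n hn => ?_)
    exact (dist_le_pi_dist (firstTerms n x) (firstTerms n y) ⟨k, hn⟩).trans (hclose n).le
  have : CompactSpace K := isCompact_iff_compactSpace.1 hK
  have hsurj : Function.Surjective H := by
    intro q
    have hq : ∀ n, ∃ x : K, (s n).toFun (firstTerms n x) = fun i : Fin n => (q i : ℝ) := by
      intro n
      obtain ⟨_, ⟨x, hx, rfl⟩, h⟩ := (s n).bijOn.surjOn
        (show (fun i : Fin n => (q i : ℝ)) ∈ Set.Icc (-1) 1 from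
          ⟨fun i => (q i).2.1, fun i => (q i).2.2⟩)
      exact ⟨⟨x, hx⟩, h⟩
    choose x hx using hq
    have htq : Filter.Tendsto (fun n => H (x n)) Filter.atTop (nhds q) := by
      refine tendsto_pi_nhds.2 fun k => tendsto_subtype_rng.2 ?_
      rw [tendsto_iff_dist_tendsto_zero]
      refine squeeze_zero' (Filter.Eventually.of_forall fun _ => dist_nonneg)
        ((Filter.eventually_gt_atTop k).mono fun n hn => ?_) htend
      have := hdist (x n) k n hn
      rw [hu _ _ _ hn, hx n, dist_comm] at this
      exact this
    exact (isCompact_range hHcont).isClosed.mem_of_tendsto htq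
      (Filter.Eventually.of_forall fun n => ⟨x n, rfl⟩)
  exact ⟨hHcont.homeoOfEquivCompactToT2 (f := Equiv.ofBijective H ⟨hinj, hsurj⟩)⟩

/-! ### Matrix coefficients on the enveloping semigroup -/

noncomputable section EnvelopingSemigroup

open Metric

variable {V : Type*} [NormedAddCommGroup V] [NormedSpace ℝ V]

instance : CompactSpace (dualBall V) :=
  isCompact_iff_compactSpace.1 (WeakDual.isCompact_closedBall (0 : StrongDual ℝ V) 1)

instance : T2Space (dualBall V) :=
  inferInstanceAs (T2Space {x : WeakDual ℝ V // x ∈ dualBall V})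

instance : CompactSpace (envelopingSemigroup V) :=
  isCompact_iff_compactSpace.1 isClosed_closure.isCompact

/-- The functional `ψ ∈ B*`, as a vector of the normed space `V*`. -/
def dualBallToDual (ψ : dualBall V) : StrongDual ℝ V :=
  WeakDual.toStrongDual (ψ : WeakDual ℝ V)

theorem norm_dualBallToDual_le (ψ : dualBall V) : ‖dualBallToDual ψ‖ ≤ 1 :=
  mem_closedBall_zero_iff.1 ψ.2

/-- The point of `B*` given by a functional of norm at most one. -/
def dualBallMk (f : StrongDual ℝ V) (hf : ‖f‖ ≤ 1) : dualBall V :=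
  ⟨StrongDual.toWeakDual f, mem_closedBall_zero_iff.2 hf⟩

/-- The underlying map of `B*` with its weak-star topology to `B*` with its norm metric. -/
def dualBallToClosedBall (ψ : dualBall V) : closedBall (0 : StrongDual ℝ V) 1 :=
  ⟨dualBallToDual ψ, ψ.2⟩

/-- The inverse of `dualBallToClosedBall`. -/
def dualBallOfClosedBall (f : closedBall (0 : StrongDual ℝ V) 1) : dualBall V :=
  ⟨StrongDual.toWeakDual (f : StrongDual ℝ V), f.2⟩

/-- The translation of `B*` by a contraction `T`, that is, the restriction of `T*` to `B*`. -/
def adjointTranslation (T : V →L[ℝ] V) (hT : ‖T‖ ≤ 1) : dualBall V → dualBall V :=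
  fun ψ => dualBallMk ((dualBallToDual ψ).comp T) ((ContinuousLinearMap.opNorm_comp_le _ _).trans
    (mul_le_one₀ (norm_dualBallToDual_le ψ) (norm_nonneg _) hT))

/-- The matrix coefficient `p ↦ ⟨v, p ψ⟩` of self-maps of `B*`. -/
def matrixCoeff (ψ : dualBall V) (v : V) (p : dualBall V → dualBall V) : ℝ :=
  dualBallToDual (p ψ) v

/-- The matrix coefficient `T ↦ ⟨T v, ψ⟩` as a functional on the space of operators. -/
def operatorCoeff (ψ : dualBall V) (v : V) : StrongDual ℝ (V →L[ℝ] V) :=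
  (dualBallToDual ψ).comp (ContinuousLinearMap.apply ℝ V v)

theorem operatorCoeff_apply (ψ : dualBall V) (v : V) (T : V →L[ℝ] V) :
    operatorCoeff ψ v T = dualBallToDual ψ (T v) := rfl

theorem matrixCoeff_adjointTranslation (ψ : dualBall V) (v : V) {T : V →L[ℝ] V} (hT : ‖T‖ ≤ 1) :
    matrixCoeff ψ v (adjointTranslation T hT) = operatorCoeff ψ v T := rfl

theorem continuous_matrixCoeff (ψ : dualBall V) (v : V) : Continuous (matrixCoeff ψ v) :=
  (WeakDual.eval_continuous v).comp (continuous_subtype_val.comp (continuous_apply ψ))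

theorem envelopingSemigroup_eq : envelopingSemigroup V =
    closure (Set.range fun T : contractionMonoid V => adjointTranslation (T : V →L[ℝ] V) T.2) := by
  have : (Set.range fun (s : (contractionMonoid V)ᵐᵒᵖ) (x : dualBall V) => s • x) =
      Set.range fun T : contractionMonoid V => adjointTranslation (T : V →L[ℝ] V) T.2 := by
    ext p
    constructor
    · rintro ⟨T, rfl⟩
      exact ⟨T.unop, rfl⟩
    · rintro ⟨T, rfl⟩
      exact ⟨MulOpposite.op T, rfl⟩
  rw [← this]
  rfl

theorem adjointTranslation_mem {T : V →L[ℝ] V} (hT : ‖T‖ ≤ 1) :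
    adjointTranslation T hT ∈ envelopingSemigroup V := by
  rw [envelopingSemigroup_eq]
  exact subset_closure ⟨⟨T, hT⟩, rfl⟩

/-- A closed condition satisfied by all adjoints of contractions holds on the enveloping
semigroup. -/
theorem envelopingSemigroup_induction {P : (dualBall V → dualBall V) → Prop}
    (hP : IsClosed {p | P p}) (h : ∀ (T : V →L[ℝ] V) (hT : ‖T‖ ≤ 1), P (adjointTranslation T hT))
    {p : dualBall V → dualBall V} (hp : p ∈ envelopingSemigroup V) : P p := by
  rw [envelopingSemigroup_eq] at hp
  refine closure_minimal ?_ hP hp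
  rintro _ ⟨T, rfl⟩
  exact h T T.2

theorem abs_matrixCoeff_le (ψ : dualBall V) (v : V) (p : dualBall V → dualBall V) :
    |matrixCoeff ψ v p| ≤ ‖v‖ :=
  ((dualBallToDual (p ψ)).le_of_opNorm_le (norm_dualBallToDual_le (p ψ)) v).trans_eq (one_mul _)

/-- Elements of the enveloping semigroup are `1`-Lipschitz for the norm of `V*`. -/
theorem abs_matrixCoeff_sub_le {p : dualBall V → dualBall V} (hp : p ∈ envelopingSemigroup V)
    (ψ ψ' : dualBall V) (v : V) :
    |matrixCoeff ψ v p - matrixCoeff ψ' v p| ≤ ‖dualBallToDual ψ - dualBallToDual ψ'‖ * ‖v‖ := by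
  refine envelopingSemigroup_induction (P := fun p => |matrixCoeff ψ v p - matrixCoeff ψ' v p| ≤
    ‖dualBallToDual ψ - dualBallToDual ψ'‖ * ‖v‖) ?_ (fun T hT => ?_) hp
  · exact isClosed_le ((continuous_matrixCoeff ψ v).sub (continuous_matrixCoeff ψ' v)).abs
      continuous_const
  · rw [matrixCoeff_adjointTranslation, matrixCoeff_adjointTranslation, operatorCoeff_apply,
      operatorCoeff_apply, ← sub_apply]
    refine ((dualBallToDual ψ - dualBallToDual ψ').le_opNorm _).trans ?_
    refine mul_le_mul_of_nonneg_left ?_ (norm_nonneg _)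
    exact (T.le_of_opNorm_le hT v).trans_eq (one_mul _)

/-- Elements of the enveloping semigroup are determined by the matrix coefficients taken from
norm-dense families in `B*` and in `V`. -/
theorem eq_of_matrixCoeff_eq {ι κ : Type*} {d : ι → dualBall V} {v : κ → V}
    (hd : DenseRange fun i => dualBallToClosedBall (d i)) (hv : DenseRange v)
    {p q : dualBall V → dualBall V} (hp : p ∈ envelopingSemigroup V)
    (hq : q ∈ envelopingSemigroup V)
    (h : ∀ i j, matrixCoeff (d i) (v j) p = matrixCoeff (d i) (v j) q) : p = q := by
  have h1 : ∀ i, p (d i) = q (d i) := by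
    intro i
    have : (dualBallToDual (p (d i)) : V → ℝ) = dualBallToDual (q (d i)) :=
      hv.equalizer (ContinuousLinearMap.continuous _) (ContinuousLinearMap.continuous _)
        (funext fun j => h i j)
    apply Subtype.ext
    exact DFunLike.coe_injective this
  funext ψ
  apply Subtype.ext
  apply DFunLike.coe_injective
  funext x
  refine eq_of_forall_dist_le fun ε hε => ?_
  obtain ⟨i, hi⟩ := hd.exists_dist_lt (dualBallToClosedBall ψ)
    (show 0 < ε / (2 * (‖x‖ + 1)) by positivity)
  have hi' : ‖dualBallToDual ψ - dualBallToDual (d i)‖ < ε / (2 * (‖x‖ + 1)) := by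
    rwa [← dist_eq_norm]
  have hb : ‖dualBallToDual ψ - dualBallToDual (d i)‖ * ‖x‖ ≤ ε / 2 := by
    have h2 : ε / (2 * (‖x‖ + 1)) * (‖x‖ + 1) = ε / 2 := by field_simp
    rw [← h2]
    gcongr
    linarith
  have hp' := abs_matrixCoeff_sub_le hp ψ (d i) x
  have hq' := abs_matrixCoeff_sub_le hq ψ (d i) x
  have he : matrixCoeff (d i) x p = matrixCoeff (d i) x q := by
    unfold matrixCoeff; rw [h1 i]
  rw [he] at hp'
  change |matrixCoeff ψ x p - matrixCoeff ψ x q| ≤ ε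
  rw [abs_le] at *
  constructor <;> linarith [hp'.1, hp'.2, hq'.1, hq'.2]

theorem norm_smulRight_le_one {g : StrongDual ℝ V} {w : V} (hg : ‖g‖ ≤ 1) (hw : ‖w‖ ≤ 1) :
    ‖(g.smulRight w : V →L[ℝ] V)‖ ≤ 1 := by
  rw [ContinuousLinearMap.norm_smulRight_apply]
  exact mul_le_one₀ hg (norm_nonneg _) hw

/-! ### Metrizability of the enveloping semigroup and separability of the dual -/

theorem separableSpace_dual_submodule [SeparableSpace (StrongDual ℝ V)] (W : Submodule ℝ V) :
    SeparableSpace (StrongDual ℝ W) := by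
  have hc : Continuous fun f : StrongDual ℝ V => f.comp W.subtypeL :=
    ((ContinuousLinearMap.compL ℝ W V ℝ).flip W.subtypeL).continuous
  refine Function.Surjective.denseRange (fun f => ?_) |>.separableSpace hc
  obtain ⟨g, hg, -⟩ := exists_extension_norm_eq W f
  exact ⟨g, ContinuousLinearMap.ext hg⟩

theorem isAsplund_of_separableSpace_dual [SeparableSpace (StrongDual ℝ V)] : IsAsplund V :=
  fun W _ _ => separableSpace_dual_submodule W

theorem IsAsplund.separableSpace_dual (h : IsAsplund V) [SeparableSpace V] :
    SeparableSpace (StrongDual ℝ V) := by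
  have e : (⊤ : Submodule ℝ V) ≃L[ℝ] V :=
    { LinearEquiv.ofTop (⊤ : Submodule ℝ V) rfl with
      continuous_toFun := continuous_subtype_val
      continuous_invFun := continuous_id.subtype_mk _ }
  have : SeparableSpace (⊤ : Submodule ℝ V) :=
    e.symm.surjective.denseRange.separableSpace e.symm.continuous
  have hT : SeparableSpace (StrongDual ℝ (⊤ : Submodule ℝ V)) := h ⊤ isClosed_univ this
  have hc : Continuous fun f : StrongDual ℝ (⊤ : Submodule ℝ V) => f.comp (e.symm : V →L[ℝ] _) :=
    ((ContinuousLinearMap.compL ℝ V (⊤ : Submodule ℝ V) ℝ).flip _).continuous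
  refine Function.Surjective.denseRange (fun f => ?_) |>.separableSpace hc
  exact ⟨f.comp (e : _ →L[ℝ] V), by ext; simp⟩

theorem separableSpace_dual_of_finiteDimensional [FiniteDimensional ℝ V] :
    SeparableSpace V ∧ SeparableSpace (StrongDual ℝ V) := by
  have : ProperSpace V := FiniteDimensional.proper_real V
  have : ProperSpace (StrongDual ℝ V) := FiniteDimensional.proper_real _
  exact ⟨inferInstance, inferInstance⟩

/-- A norm-dense sequence in `B*`. -/
theorem exists_denseRange_dualBall [SeparableSpace (StrongDual ℝ V)] :
    ∃ d : ℕ → dualBall V, DenseRange fun i => dualBallToClosedBall (d i) := by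
  have : SecondCountableTopology (StrongDual ℝ V) := UniformSpace.secondCountable_of_separable _
  have : Nonempty (closedBall (0 : StrongDual ℝ V) 1) := ⟨⟨0, by simp⟩⟩
  exact ⟨fun i => dualBallOfClosedBall (denseSeq (closedBall (0 : StrongDual ℝ V) 1) i),
    denseRange_denseSeq (closedBall (0 : StrongDual ℝ V) 1)⟩

theorem metrizableSpace_envelopingSemigroup [SeparableSpace V] [SeparableSpace (StrongDual ℝ V)] :
    MetrizableSpace (envelopingSemigroup V) := by
  obtain ⟨d, hd⟩ := exists_denseRange_dualBall (V := V)
  let F : envelopingSemigroup V → (ℕ × ℕ → ℝ) := fun p k => matrixCoeff (d k.1) (denseSeq V k.2) p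
  have hF : Continuous F :=
    continuous_pi fun k => (continuous_matrixCoeff _ _).comp continuous_subtype_val
  have hinj : Function.Injective F := fun p q hpq =>
    Subtype.ext (eq_of_matrixCoeff_eq hd (denseRange_denseSeq V) p.2 q.2
      fun i j => congrFun hpq (i, j))
  exact (hF.isClosedEmbedding hinj).isEmbedding.metrizableSpace

/-- A matrix coefficient as a continuous function on the enveloping semigroup. -/
def matrixCoeffMap (ψ : dualBall V) (v : V) : C(envelopingSemigroup V, ℝ) :=
  ⟨fun p => matrixCoeff ψ v p, (continuous_matrixCoeff ψ v).comp continuous_subtype_val⟩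

theorem abs_operatorCoeff_sub_le_dist (ψ ψ' : dualBall V) (v v' : V) {T : V →L[ℝ] V}
    (hT : ‖T‖ ≤ 1) :
    |operatorCoeff ψ v T - operatorCoeff ψ' v' T| ≤
      dist (matrixCoeffMap ψ v) (matrixCoeffMap ψ' v') := by
  rw [← Real.dist_eq]
  exact ContinuousMap.dist_apply_le_dist (f := matrixCoeffMap ψ v) (g := matrixCoeffMap ψ' v')
    ⟨adjointTranslation T hT, adjointTranslation_mem hT⟩

/-- If `w` is a unit vector, then `ψ ↦ (p ↦ ⟨w, p ψ⟩)` is an isometric embedding of `B*` with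
the norm metric into `C(𝓔(V))`. -/
theorem dist_matrixCoeffMap_left {w : V} (hw : ‖w‖ = 1) (ψ ψ' : dualBall V) :
    dist (matrixCoeffMap ψ w) (matrixCoeffMap ψ' w) = dist (dualBallToDual ψ) (dualBallToDual ψ') := by
  apply le_antisymm
  · refine (ContinuousMap.dist_le dist_nonneg).2 fun p => ?_
    have := abs_matrixCoeff_sub_le p.2 ψ ψ' w
    rwa [hw, mul_one, ← dist_eq_norm, ← Real.dist_eq] at this
  · rw [dist_eq_norm (dualBallToDual ψ)]
    refine ContinuousLinearMap.opNorm_le_bound _ dist_nonneg fun v => ?_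
    rcases eq_or_ne v 0 with rfl | hv
    · simp
    obtain ⟨g, hg, hgw⟩ := exists_dual_vector ℝ w (hw ▸ one_ne_zero)
    have hgw' : g w = 1 := by simpa [hw] using hgw
    -- test on the rank-one operator that sends `w` to the direction of `v`
    have hT := norm_smulRight_le_one hg.le (w := ‖v‖⁻¹ • v) (by
      rw [norm_smul, norm_inv, norm_norm, inv_mul_cancel₀ (norm_ne_zero_iff.2 hv)])
    have h := abs_operatorCoeff_sub_le_dist ψ ψ' w w hT
    rw [operatorCoeff_apply, operatorCoeff_apply, ContinuousLinearMap.smulRight_apply, hgw',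
      one_smul, map_smul, map_smul, ← smul_sub, smul_eq_mul, abs_mul, abs_inv, abs_norm,
      inv_mul_le_iff₀ (norm_pos_iff.2 hv), mul_comm] at h
    exact h

/-- If `ψ` attains its norm one at a unit vector `w`, then `v ↦ (p ↦ ⟨v, p ψ⟩)` is an isometric
embedding of `V` into `C(𝓔(V))`. -/
theorem dist_matrixCoeffMap_right {w : V} (hw : ‖w‖ = 1) {ψ : dualBall V}
    (hψ : dualBallToDual ψ w = 1) (v v' : V) :
    dist (matrixCoeffMap ψ v) (matrixCoeffMap ψ v') = dist v v' := by
  apply le_antisymm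
  · refine (ContinuousMap.dist_le dist_nonneg).2 fun p => ?_
    rw [dist_eq_norm v, Real.dist_eq]
    have h : matrixCoeff ψ v p - matrixCoeff ψ v' p = matrixCoeff ψ (v - v') p :=
      (map_sub (dualBallToDual ((p : dualBall V → dualBall V) ψ)) v v').symm
    exact (congrArg abs h).trans_le (abs_matrixCoeff_le ψ (v - v') p)
  · rcases eq_or_ne v v' with rfl | hv
    · simp
    -- test on the rank-one operator `x ↦ g x • w`, where `g` norms `v - v'`
    obtain ⟨g, hg, hgv⟩ := exists_dual_vector ℝ (v - v') (norm_ne_zero_iff.2 (sub_ne_zero.2 hv))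
    have h := abs_operatorCoeff_sub_le_dist ψ ψ v v' (norm_smulRight_le_one hg.le hw.le)
    rw [operatorCoeff_apply, operatorCoeff_apply, ContinuousLinearMap.smulRight_apply,
      ContinuousLinearMap.smulRight_apply, map_smul, map_smul, hψ, smul_eq_mul, smul_eq_mul,
      mul_one, mul_one, ← map_sub, hgv] at h
    simpa [dist_eq_norm v] using h

theorem separableSpace_of_metrizableSpace [MetrizableSpace (envelopingSemigroup V)] :
    SeparableSpace V ∧ SeparableSpace (StrongDual ℝ V) := by
  -- a zero space has no unit vector
  rcases subsingleton_or_nontrivial V with hV | hV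
  · exact separableSpace_dual_of_finiteDimensional
  let : MetricSpace (envelopingSemigroup V) := metrizableSpaceMetric _
  have : SecondCountableTopology C(envelopingSemigroup V, ℝ) := inferInstance
  obtain ⟨w, hw⟩ := exists_norm_eq V zero_le_one
  obtain ⟨g, hg, hgw⟩ := exists_dual_vector ℝ w (hw ▸ one_ne_zero)
  have hgw' : g w = 1 := by simpa [hw] using hgw
  constructor
  · have hi : Isometry fun v : V => matrixCoeffMap (dualBallMk g hg.le) v :=
      Isometry.of_dist_eq fun v v' => dist_matrixCoeffMap_right hw (ψ := dualBallMk g hg.le) hgw' v v'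
    have : SecondCountableTopology V := hi.isEmbedding.isInducing.secondCountableTopology
    infer_instance
  · have hi : Isometry fun f : closedBall (0 : StrongDual ℝ V) 1 =>
        matrixCoeffMap (dualBallOfClosedBall f) w :=
      Isometry.of_dist_eq fun f f' => dist_matrixCoeffMap_left hw _ _
    have : SecondCountableTopology (closedBall (0 : StrongDual ℝ V) 1) :=
      hi.isEmbedding.isInducing.secondCountableTopology
    have hs : IsSeparable (closedBall (0 : StrongDual ℝ V) 1) := IsSeparable.of_subtype _
    have h := hs.span (R := ℝ)
    have htop : Submodule.span ℝ (closedBall (0 : StrongDual ℝ V) 1) = ⊤ := by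
      rw [Submodule.eq_top_iff']
      intro f
      have hf : f = (‖f‖ + 1) • (‖f‖ + 1)⁻¹ • f := by
        rw [smul_smul, mul_inv_cancel₀ (by positivity), one_smul]
      rw [hf]
      refine Submodule.smul_mem _ _ (Submodule.subset_span (mem_closedBall_zero_iff.2 ?_))
      rw [norm_smul, norm_inv, Real.norm_of_nonneg (by positivity), inv_mul_le_iff₀ (by positivity)]
      linarith
    rw [htop, Submodule.top_coe] at h
    exact isSeparable_univ_iff.1 h

/-! ### Embedding the enveloping semigroup into the space of sequences -/

theorem surjective_pi_of_linearIndependent {K X ι : Type*} [Field K] [AddCommGroup X] [Module K X]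
    [Finite ι] {f : ι → X →ₗ[K] K} (hf : LinearIndependent K f) :
    Function.Surjective (LinearMap.pi f) := by
  classical
  have := Fintype.ofFinite ι
  rw [← LinearMap.dualMap_injective_iff, injective_iff_map_eq_zero]
  intro φ hφ
  have h : ∑ i, φ (Pi.single i 1) • f i = 0 := by
    ext x
    have h1 := LinearMap.congr_fun hφ x
    rw [LinearMap.dualMap_apply, LinearMap.pi_apply_eq_sum_univ] at h1
    have h2 : ∀ i, (Pi.single i 1 : ι → K) = fun j => if i = j then 1 else 0 := fun i => by
      ext j
      simp [Pi.single_apply, eq_comm]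
    simpa [mul_comm, h2] using h1
  have h0 := Fintype.linearIndependent_iff.1 hf _ h
  ext i
  simpa using h0 i

/-- Linear relations among matrix coefficients of operators persist on the enveloping semigroup. -/
theorem matrixCoeff_eq_sum {ι : Type*} {e : ι → dualBall V × V} {c : ι →₀ ℝ} {ψ : dualBall V}
    {v : V} (h : (c.sum fun i a => a • operatorCoeff (e i).1 (e i).2) = operatorCoeff ψ v)
    {p : dualBall V → dualBall V} (hp : p ∈ envelopingSemigroup V) :
    matrixCoeff ψ v p = c.sum fun i a => a * matrixCoeff (e i).1 (e i).2 p := by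
  refine envelopingSemigroup_induction
    (P := fun p => matrixCoeff ψ v p = c.sum fun i a => a * matrixCoeff (e i).1 (e i).2 p)
    ?_ (fun T hT => ?_) hp
  · exact isClosed_eq (continuous_matrixCoeff ψ v)
      (continuous_finsetSum _ fun i _ => continuous_const.mul (continuous_matrixCoeff _ _))
  · simp only [matrixCoeff_adjointTranslation]
    rw [← h, Finsupp.sum, sum_apply]
    rfl

theorem finiteDimensional_comap_of_injective {K X Y : Type*} [Field K] [AddCommGroup X] [Module K X]
    [AddCommGroup Y] [Module K Y] {f : X →ₗ[K] Y} (hf : Function.Injective f) {S : Submodule K Y}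
    [FiniteDimensional K S] : FiniteDimensional K (S.comap f) :=
  Module.Finite.of_injective (f.restrict (p := S.comap f) (q := S) fun _ h => h)
    fun _ _ hxy => Subtype.ext (hf (Subtype.ext_iff.1 hxy))

theorem eq_zero_of_operatorCoeff_eq_zero {ψ : dualBall V} (hψ : dualBallToDual ψ ≠ 0) {v : V}
    (hv : operatorCoeff ψ v = 0) : v = 0 := by
  by_contra hv0
  obtain ⟨w, hw⟩ := DFunLike.ne_iff.1 hψ
  obtain ⟨g, -, hgv⟩ := exists_dual_vector ℝ v (norm_ne_zero_iff.2 hv0)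
  have h := DFunLike.congr_fun hv (g.smulRight w)
  rw [operatorCoeff_apply, ContinuousLinearMap.smulRight_apply, map_smul, hgv] at h
  simp only [RCLike.ofReal_real_eq_id, id_eq, smul_eq_mul, zero_apply,
    mul_eq_zero, norm_eq_zero] at h
  exact h.elim hv0 hw

/-- On an infinite-dimensional space with separable dual there is a sequence of linearly
independent matrix coefficients that separates the points of the enveloping semigroup. -/
theorem exists_linearIndependent_operatorCoeff [SeparableSpace V] [SeparableSpace (StrongDual ℝ V)]
    (hV : ¬ FiniteDimensional ℝ V) :
    ∃ e : ℕ → dualBall V × V, LinearIndependent ℝ (fun k => operatorCoeff (e k).1 (e k).2) ∧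
      ∀ p ∈ envelopingSemigroup V, ∀ q ∈ envelopingSemigroup V,
        (∀ k, matrixCoeff (e k).1 (e k).2 p = matrixCoeff (e k).1 (e k).2 q) → p = q := by
  obtain ⟨d, hd⟩ := exists_denseRange_dualBall (V := V)
  let f : ℕ × ℕ → StrongDual ℝ (V →L[ℝ] V) := fun k => operatorCoeff (d k.1) (denseSeq V k.2)
  obtain ⟨κ, a, ha, hspan, hli⟩ := exists_linearIndependent' ℝ f
  have hcount : Countable κ := ha.countable
  -- some member of the dense sequence is nonzero
  obtain ⟨i, hi⟩ : ∃ i, dualBallToDual (d i) ≠ 0 := by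
    by_contra! hcon
    have : Nontrivial V := by
      by_contra h
      rw [not_nontrivial_iff_subsingleton] at h
      exact hV inferInstance
    obtain ⟨w, hw⟩ := exists_ne (0 : V)
    obtain ⟨g, hg, -⟩ := exists_dual_vector ℝ w (norm_ne_zero_iff.2 hw)
    obtain ⟨i, hi⟩ := hd.exists_dist_lt (⟨g, mem_closedBall_zero_iff.2 hg.le⟩ :
      closedBall (0 : StrongDual ℝ V) 1) one_pos
    have hi' : dist g (dualBallToDual (d i)) < 1 := hi
    rw [hcon i, dist_zero_right, hg] at hi'
    exact lt_irrefl _ hi'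
  -- otherwise the vectors whose coefficients with `d i` lie in the span form a dense
  -- finite-dimensional subspace of `V`
  have hinf : Infinite κ := by
    by_contra hfin
    rw [not_infinite_iff_finite] at hfin
    have hfd : FiniteDimensional ℝ (Submodule.span ℝ (Set.range f)) := by
      rw [← hspan]
      exact FiniteDimensional.span_of_finite ℝ (Set.finite_range _)
    let Λ : V →ₗ[ℝ] StrongDual ℝ (V →L[ℝ] V) :=
      { toFun := operatorCoeff (d i)
        map_add' := fun x y => by ext T; simp [operatorCoeff_apply]
        map_smul' := fun c x => by ext T; simp [operatorCoeff_apply] }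
    have hΛ : Function.Injective Λ := (injective_iff_map_eq_zero Λ).2 fun v hv =>
      eq_zero_of_operatorCoeff_eq_zero hi hv
    let W : Submodule ℝ V := (Submodule.span ℝ (Set.range f)).comap Λ
    have hW : FiniteDimensional ℝ W := finiteDimensional_comap_of_injective hΛ
    have hdense : Dense (W : Set V) := (denseRange_denseSeq V).mono (by
      rintro _ ⟨j, rfl⟩
      exact Submodule.subset_span ⟨(i, j), rfl⟩)
    have htop : W = ⊤ := by
      rw [← SetLike.coe_set_eq, Submodule.top_coe, ← hdense.closure_eq]
      exact W.closed_of_finiteDimensional.closure_eq.symm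
    rw [htop] at hW
    exact hV (LinearEquiv.finiteDimensional (LinearEquiv.ofTop (⊤ : Submodule ℝ V) rfl))
  obtain ⟨σ⟩ : Nonempty (ℕ ≃ κ) := nonempty_equiv_of_countable
  refine ⟨fun k => (d (a (σ k)).1, denseSeq V (a (σ k)).2), hli.comp σ σ.injective, ?_⟩
  intro p hp q hq hpq
  refine eq_of_matrixCoeff_eq hd (denseRange_denseSeq V) hp hq fun i j => ?_
  have hmem : f (i, j) ∈ Submodule.span ℝ (Set.range (f ∘ a)) := by
    rw [hspan]
    exact Submodule.subset_span ⟨(i, j), rfl⟩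
  obtain ⟨c, hc⟩ := Finsupp.mem_span_range_iff_exists_finsupp.1 hmem
  have hp' := matrixCoeff_eq_sum (e := fun k => (d (a k).1, denseSeq V (a k).2)) hc hp
  have hq' := matrixCoeff_eq_sum (e := fun k => (d (a k).1, denseSeq V (a k).2)) hc hq
  rw [hp', hq']
  refine Finsupp.sum_congr fun k _ => ?_
  have := hpq (σ.symm k)
  simp only [Equiv.apply_symm_apply] at this
  rw [this]

/-- The enveloping semigroup is homeomorphic to a compact convex set of sequences, the closure of
a linear image of the unit ball of operators, to which Keller's theorem applies. -/
theorem nonempty_homeomorph_envelopingSemigroup [CompleteSpace V] [SeparableSpace V]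
    [SeparableSpace (StrongDual ℝ V)] (hV : ¬ FiniteDimensional ℝ V) :
    Nonempty (envelopingSemigroup V ≃ₜ (ℕ → Set.Icc (-1 : ℝ) 1)) := by
  obtain ⟨e, hli, hsep⟩ := exists_linearIndependent_operatorCoeff hV
  let F : (dualBall V → dualBall V) → (ℕ → ℝ) := fun p k => matrixCoeff (e k).1 (e k).2 p
  have hF : Continuous F := continuous_pi fun k => continuous_matrixCoeff _ _
  let Λ : (V →L[ℝ] V) →L[ℝ] (ℕ → ℝ) :=
    ContinuousLinearMap.pi fun k => operatorCoeff (e k).1 (e k).2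
  let K : Set (ℕ → ℝ) := F '' envelopingSemigroup V
  have hKc : IsCompact K := (isClosed_closure.isCompact (X := dualBall V → dualBall V)).image hF
  have hK : K = closure (Λ '' closedBall 0 1) := by
    have hc : IsCompact (closure (Set.range fun T : contractionMonoid V =>
      adjointTranslation (T : V →L[ℝ] V) T.2)) := isClosed_closure.isCompact
    change F '' envelopingSemigroup V = _
    rw [envelopingSemigroup_eq, image_closure_of_isCompact hc hF.continuousOn]
    congr 1
    ext x
    constructor
    · rintro ⟨_, ⟨T, rfl⟩, rfl⟩
      exact ⟨T, mem_closedBall_zero_iff.2 T.2, rfl⟩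
    · rintro ⟨T, hT, rfl⟩
      exact ⟨_, ⟨⟨T, mem_closedBall_zero_iff.1 hT⟩, rfl⟩, rfl⟩
  have hconv : Convex ℝ K := by
    rw [hK]
    exact ((convex_closedBall 0 1).linear_image Λ.toLinearMap).closure
  have h₀ : ∀ n, firstTerms n '' K ∈ nhds 0 := by
    intro n
    have hsurj : Function.Surjective ((firstTerms n).comp Λ) := by
      have hli' : LinearIndependent ℝ fun i : Fin n =>
          (operatorCoeff (e i).1 (e i).2 : (V →L[ℝ] V) →ₗ[ℝ] ℝ) :=
        (hli.map' (ContinuousLinearMap.coeLM ℝ) (LinearMap.ker_eq_bot.2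
          ContinuousLinearMap.coe_injective)).comp Fin.val Fin.val_injective
      exact surjective_pi_of_linearIndependent hli'
    have hopen := ((firstTerms n).comp Λ).isOpenMap hsurj
    have h1 := hopen.image_mem_nhds (closedBall_mem_nhds (0 : V →L[ℝ] V) one_pos)
    rw [map_zero] at h1
    refine Filter.mem_of_superset h1 ?_
    rintro _ ⟨T, hT, rfl⟩
    refine ⟨Λ T, ?_, rfl⟩
    rw [hK]
    exact subset_closure (Set.mem_image_of_mem _ hT)
  obtain ⟨η⟩ := nonempty_homeomorph_hilbertCube hKc hconv h₀
  have hbij : Set.BijOn F (envelopingSemigroup V) K := ⟨Set.mapsTo_image _ _,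
    fun p hp q hq hpq => hsep p hp q hq (congrFun hpq), Set.surjOn_image _ _⟩
  have hcont : Continuous (hbij.equiv F) :=
    (hF.comp continuous_subtype_val).subtype_mk _
  exact ⟨hcont.homeoOfEquivCompactToT2.trans η⟩

end EnvelopingSemigroup

theorem theoremt (V : Type*) [NormedAddCommGroup V] [NormedSpace ℝ V] [CompleteSpace V] :
    List.TFAE
      [ SeparableSpace V ∧ IsAsplund V,
        ¬ FiniteDimensional ℝ V →
          Nonempty (envelopingSemigroup V ≃ₜ (ℕ → Set.Icc (-1 : ℝ) 1)),
        MetrizableSpace (envelopingSemigroup V) ] := by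
  tfae_have 1 → 2 := by
    rintro ⟨hs, hA⟩ hV
    have := hA.separableSpace_dual
    exact nonempty_homeomorph_envelopingSemigroup hV
  tfae_have 2 → 3 := by
    intro h
    by_cases hV : FiniteDimensional ℝ V
    · obtain ⟨_, _⟩ := separableSpace_dual_of_finiteDimensional (V := V)
      exact metrizableSpace_envelopingSemigroup
    · obtain ⟨η⟩ := h hV
      exact η.isEmbedding.metrizableSpace
  tfae_have 3 → 1 := by
    intro h
    obtain ⟨hs, _⟩ := separableSpace_of_metrizableSpace (V := V)
    exact ⟨hs, isAsplund_of_separableSpace_dual⟩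
  tfae_finish
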